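/- **Model.** An oracle is a function $O:\{0,1\}^*\to\{0,1\}$ (equivalently, a subset of $\{0,1\}^*$); $U_{O,k}$ is the unitary $|x\rangle|y\rangle\mapsto|x\rangle|y\oplus O(x)\rangle$ with $x\in\{0,1\}^k$, $y\in\{0,1\}$. For $\lambda\in(0,1)$ let $D_\lambda[\rho]=(1-\lambda)\rho+\lambda\,\mathrm{tr}(\rho)I/2$ be the single-qubit depolarizing channel. A $\lambda$-noisy circuit with $n'$ qubits and layers $U_1,\dots,U_T$, where each $U_t$ is either a depth-1 unitary (a tensor product of one- and two-qubit gates on pairwise disjoint sets of qubits, identity elsewhere) or $U_{O,k}\otimes I$ with $k<n'$ (acting on the first $k+1$ qubits), outputs $s\in\{0,1\}^{n'}$ with probability $$p(s)=\langle s|D_\lambda^{\otimes n'}\bigl[U_T\cdots D_\lambda^{\otimes n'}\bigl[U_1D_\lambda^{\otimes n'}[|0^{n'}\rangle\langle0^{n'}|]U_1^\dagger\bigr]\cdots U_T^\dagger\bigr]|s\rangle .$$ A $\mathsf{BQP}_\lambda$ algorithm with access to $O$ is a probabilistic Turing machine that can query $O$ classically (at unit cost) and can, any number of times, write down a $\lambda$-noisy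 circuit over a finite gate set of its own (one- and two-qubit unitaries with algebraic entries) and receive one sample of its output (at additional cost $1+n'T$). A language $L\subseteq\{0,1\}^*$ is in $\mathsf{BQP}_\lambda^{O}$ if some such algorithm halts on every input $x$ in time $\mathrm{poly}(|x|)$, outputs $1$ with probability at least $2/3$ if $x\in L$, and outputs $0$ with probability at least $2/3$ if $x\notin L$. $\mathsf{NP}^{O}$ is the class of languages accepted by polynomial-time nondeterministic Turing machines with access to $O$. **Theorem.** There exist a constant $\lambda\in(0,1)$, which may be taken rational, and an oracle $O$ such that $$\mathsf{BQP}_\lambda^{O}\not\subset\mathsf{NP}^{O}.$$ The separation is witnessed by the Deutsch–Jozsa problem: $\lambda$ and $O$ can be chosen such that, for every $n$, the restriction of $O$ to $\{0,1\}^n$ is identically $0$ or takes the value $1$ on exactly half of $\{0,1\}^n$, and such that the language $S(O)=\{1^n : O(x)=0 \text{ for all } x\in\{0,1\}^n\}$ is in $\mathsf{BQP}_\lambda^{O}$ but not in $\mathsf{NP}^{O}$. -/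

import Mathlib

namespace NoisyQuantum

/-! ## Oracles -/

/-- A classical oracle: for every `n` a function from `n`-bit strings to one bit
(equivalently, a set of bit strings). -/
abbrev Oracle : Type := List Bool → Bool

/-! ## Noisy quantum circuits

The computational basis of `n` qubits is `Fin n → Bool`, so an operator on `n` qubits is a matrix
indexed by `Fin n → Bool`. -/

/-- The bit of the basis state `x` at qubit `i` (`false` if there is no such qubit). -/
def bit {n : ℕ} (x : Fin n → Bool) (i : ℕ) : Bool :=
  if h : i < n then x ⟨i, h⟩ else false

/-- A finite set of one-qubit and two-qubit gates. As usual for a gate set that is named by finitely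
many symbols, the matrix entries are required to be algebraic numbers, so that no gate can hide an
uncomputable real number. -/
structure GateSet where
  /-- Names of the one-qubit gates. -/
  One : Type
  /-- Names of the two-qubit gates. -/
  Two : Type
  [finOne : Finite One]
  [finTwo : Finite Two]
  /-- The unitary of a one-qubit gate. -/
  one : One → Matrix.unitaryGroup Bool ℂ
  /-- The unitary of a two-qubit gate. -/
  two : Two → Matrix.unitaryGroup (Bool × Bool) ℂ
  algebraic_one : ∀ g a b, IsAlgebraic ℚ ((one g : Matrix Bool Bool ℂ) a b)
  algebraic_two : ∀ g a b,
    IsAlgebraic ℚ ((two g : Matrix (Bool × Bool) (Bool × Bool) ℂ) a b)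

/-- One gate placed on one qubit, or on an ordered pair of qubits. -/
inductive Placed (G : GateSet) : Type
  | one (g : G.One) (i : ℕ)
  | two (g : G.Two) (i j : ℕ)

/-- The qubits that a placed gate acts on. -/
def Placed.support {G : GateSet} : Placed G → List ℕ
  | .one _ i => [i]
  | .two _ i j => [i, j]

/-- The operator on `n` qubits of a placed gate: the gate on its qubits, tensored with the identity
on all other qubits. -/
def Placed.toMatrix {G : GateSet} (n : ℕ) :
    Placed G → Matrix (Fin n → Bool) (Fin n → Bool) ℂ
  | .one g i => fun x y =>
      if ∀ l : Fin n, (l : ℕ) ≠ i → x l = y l then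
        (G.one g : Matrix Bool Bool ℂ) (bit x i) (bit y i)
      else 0
  | .two g i j => fun x y =>
      if ∀ l : Fin n, (l : ℕ) ≠ i → (l : ℕ) ≠ j → x l = y l then
        (G.two g : Matrix (Bool × Bool) (Bool × Bool) ℂ) (bit x i, bit x j) (bit y i, bit y j)
      else 0

/-- A layer of a circuit: a depth-1 unitary (gates on pairwise disjoint sets of qubits), or the
oracle unitary for inputs of length `k`, tensored with the identity. -/
inductive Layer (G : GateSet) : Type
  | gates (ops : List (Placed G))
  | oracle (k : ℕ)

/-- A layer makes sense on `n` qubits: the gates act on existing and pairwise different qubits; an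
oracle layer has its `k` input qubits `0, …, k - 1` and its target qubit `k`. -/
def Layer.Valid {G : GateSet} (n : ℕ) : Layer G → Prop
  | .gates ops => (ops.flatMap Placed.support).Nodup ∧ ∀ i ∈ ops.flatMap Placed.support, i < n
  | .oracle k => k < n

/-- The unitary of a layer. For gates on disjoint qubits the product is the tensor product. An oracle
layer is `|x⟩|y⟩|z⟩ ↦ |x⟩|y ⊕ O(x)⟩|z⟩` with `x` the first `k` qubits and `y` the next one. -/
def Layer.toMatrix {G : GateSet} (O : Oracle) (n : ℕ) :
    Layer G → Matrix (Fin n → Bool) (Fin n → Bool) ℂ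
  | .gates ops => (ops.map (Placed.toMatrix n)).prod
  | .oracle k => fun z w =>
      if (∀ l : Fin n, (l : ℕ) ≠ k → z l = w l) ∧
          bit z k = xor (bit w k) (O ((List.ofFn w).take k)) then 1
      else 0

/-- A quantum circuit on `qubits` qubits; the first layer of the list is applied first. -/
structure Circuit (G : GateSet) where
  qubits : ℕ
  layers : List (Layer G)

/-- All layers make sense on the qubits of the circuit. -/
def Circuit.Valid {G : GateSet} (C : Circuit G) : Prop :=
  ∀ L ∈ C.layers, L.Valid C.qubits

/-- The single-qubit depolarizing channel `D[ρ] = (1 - lam) ρ + lam tr(ρ) I / 2`, applied to qubit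
`i` of an `n`-qubit state (and the identity channel on the other qubits). -/
noncomputable def depolarize {n : ℕ} (lam : ℝ) (i : Fin n)
    (ρ : Matrix (Fin n → Bool) (Fin n → Bool) ℂ) : Matrix (Fin n → Bool) (Fin n → Bool) ℂ :=
  fun x y => (1 - (lam : ℂ)) * ρ x y +
    (lam : ℂ) * (if x i = y i then
      (∑ b : Bool, ρ (Function.update x i b) (Function.update y i b)) / 2 else 0)

/-- A layer of noise: the depolarizing channel on every qubit. -/
noncomputable def depolarizeAll {n : ℕ} (lam : ℝ)
    (ρ : Matrix (Fin n → Bool) (Fin n → Bool) ℂ) : Matrix (Fin n → Bool) (Fin n → Bool) ℂ :=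
  (List.finRange n).foldl (fun τ i => depolarize lam i τ) ρ

/-- The state `|0…0⟩⟨0…0|`. -/
def zeroState (n : ℕ) : Matrix (Fin n → Bool) (Fin n → Bool) ℂ :=
  Matrix.single (fun _ => false) (fun _ => false) 1

/-- The final state of a noisy circuit: noise acts on the initial state and after every layer. -/
noncomputable def Circuit.finalState {G : GateSet} (O : Oracle) (lam : ℝ) (C : Circuit G) :
    Matrix (Fin C.qubits → Bool) (Fin C.qubits → Bool) ℂ :=
  C.layers.foldl
    (fun ρ L => depolarizeAll lam
      (L.toMatrix O C.qubits * ρ * (L.toMatrix O C.qubits).conjTranspose))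
    (depolarizeAll lam (zeroState C.qubits))

/-- The probability that measuring all qubits of the noisy circuit gives `s`. The noise rate `lam` is
a function of the number of qubits. -/
noncomputable def Circuit.outputProb {G : GateSet} (O : Oracle) (lam : ℕ → ℝ) (C : Circuit G)
    (s : Fin C.qubits → Bool) : ℝ :=
  (C.finalState O (lam C.qubits) s s).re

/-! ## How a machine describes a circuit to the noisy device

The machine writes a string of symbols; the device reads them in the order in which they were
written and builds the circuit. Numbers are written in unary. -/

/-- The symbols of circuit descriptions. -/
inductive DeviceSymbol (G : GateSet) : Type
  /-- increase the current number by one -/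
  | tick
  /-- store the current number as first qubit of a pair, and reset it -/
  | mark
  /-- place a one-qubit gate at the current number, and reset it -/
  | one (g : G.One)
  /-- place a two-qubit gate at the stored and the current number, and reset both -/
  | two (g : G.Two)
  /-- finish a layer consisting of the gates placed since the last such symbol -/
  | endLayer
  /-- add an oracle layer whose input length is the current number, and reset it -/
  | oracle

/-- The state of the device while it reads a description. -/
structure Reader (G : GateSet) where
  current : ℕ
  stored : ℕ
  placed : List (Placed G)
  layers : List (Layer G)

/-- The device reads one symbol. -/
def Reader.read {G : GateSet} (r : Reader G) : DeviceSymbol G → Reader G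
  | .tick => { r with current := r.current + 1 }
  | .mark => { r with stored := r.current, current := 0 }
  | .one g => { r with placed := r.placed ++ [.one g r.current], current := 0 }
  | .two g => { r with
      placed := r.placed ++ [.two g r.stored r.current], stored := 0, current := 0 }
  | .endLayer => { r with layers := r.layers ++ [.gates r.placed], placed := [] }
  | .oracle => { r with layers := r.layers ++ [.oracle r.current], current := 0 }

/-- The device reads a whole description, given as a stack (the symbol written last is the head). -/
def Reader.readAll {G : GateSet} (w : List (DeviceSymbol G)) : Reader G :=
  w.foldr (fun a r => r.read a) ⟨0, 0, [], []⟩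

/-- The circuit with a given description; the last number written is the number of qubits. -/
def Circuit.ofDescription {G : GateSet} (w : List (DeviceSymbol G)) : Circuit G :=
  ⟨(Reader.readAll w).current, (Reader.readAll w).layers⟩

/-! ## Turing machines with a classical oracle and a noisy quantum device

Machines are multi-stack Turing machines in the sense of `Turing.TM2`, with additional instructions
for a binary choice, a query to the classical oracle, and a call of the noisy quantum device. -/

/-- The special stacks of a machine. -/
inductive Port : Type
  | input
  | query
  | circuit
  | sample
  deriving DecidableEq

/-- The stack alphabets: bits on the special stacks other than `circuit`, device symbols on
`circuit`, and arbitrary alphabets on the work stacks. -/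
def Alphabet (G : GateSet) {W : Type} (Γ : W → Type) : Port ⊕ W → Type
  | .inl .input => Bool
  | .inl .query => Bool
  | .inl .circuit => DeviceSymbol G
  | .inl .sample => Bool
  | .inr w => Γ w

/-- What a machine does at a given label. -/
inductive Action (G : GateSet) {W : Type} (Γ : W → Type) (Λ σ : Type) : Type
  /-- run ordinary instructions -/
  | run (q : Turing.TM2.Stmt (Alphabet G Γ) Λ σ)
  /-- make a binary choice (a fair coin flip or a nondeterministic choice) and jump accordingly -/
  | choose (next : Bool → Λ)
  /-- query the classical oracle on the word on the query stack and jump according to the answer -/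
  | oracle (next : Bool → Λ)
  /-- have the circuit described on the circuit stack sampled once, then jump -/
  | device (next : Λ)

/-- A machine: finitely many work stacks, stack symbols, labels and internal states. -/
structure Machine where
  /-- the gates that can be used in calls of the device -/
  G : GateSet
  /-- the work stacks -/
  W : Type
  [decW : DecidableEq W]
  [finW : Finite W]
  /-- the alphabets of the work stacks -/
  Γ : W → Type
  [finΓ : ∀ w, Finite (Γ w)]
  /-- the labels -/
  Λ : Type
  [finΛ : Finite Λ]
  /-- the internal states -/
  σ : Type
  [finσ : Finite σ]
  /-- the label at which the machine starts -/
  main : Λ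
  /-- the internal state in which the machine starts -/
  start : σ
  /-- the program -/
  code : Λ → Action G Γ Λ σ
  /-- the output bit, as a function of the internal state in which the machine halts -/
  output : σ → Bool

attribute [instance] Machine.decW

namespace Machine

variable (M : Machine)

/-- Configurations: a label (`none` if the machine has halted), an internal state, the stacks. -/
abbrev Cfg : Type := Turing.TM2.Cfg (Alphabet M.G M.Γ) M.Λ M.σ

/-- The stacks at the start: the input word on the input stack (first letter on top). -/
def initStacks (x : List Bool) : ∀ k : Port ⊕ M.W, List (Alphabet M.G M.Γ k)
  | .inl .input => x
  | _ => []

/-- The initial configuration on input `x`. -/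
def init (x : List Bool) : M.Cfg := ⟨some M.main, M.start, M.initStacks x⟩

/-- The ways in which a computation can go on from a configuration. -/
inductive Next : Type
  /-- the machine has halted with an output bit -/
  | halted (b : Bool)
  /-- the next configuration is determined -/
  | step (c : M.Cfg)
  /-- the next configuration depends on a binary choice -/
  | choose (c : Bool → M.Cfg)
  /-- the next configuration depends on a sample from a noisy circuit -/
  | sample (C : Circuit M.G) (c : (Fin C.qubits → Bool) → M.Cfg)

open Classical in
/-- One step of the machine. A query erases the query stack. A call of the device erases the circuit
stack and replaces the content of the sample stack by the sampled string (by the empty string if the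
description is not that of a circuit). -/
noncomputable def next (O : Oracle) : M.Cfg → M.Next
  | ⟨none, v, _⟩ => .halted (M.output v)
  | ⟨some l, v, S⟩ =>
    match M.code l with
    | .run q => .step (Turing.TM2.stepAux q v S)
    | .choose f => .choose fun b => ⟨some (f b), v, S⟩
    | .oracle f =>
        .step ⟨some (f (O (S (.inl .query)))), v, Function.update S (.inl .query) []⟩
    | .device l' =>
        let C : Circuit M.G := Circuit.ofDescription (S (.inl .circuit))
        let S' := Function.update S (.inl .circuit) []
        if C.Valid then
          .sample C fun s => ⟨some l', v, Function.update S' (.inl .sample) (List.ofFn s)⟩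
        else
          .step ⟨some l', v, Function.update S' (.inl .sample) []⟩

/-- `M.HaltsWithin O t c`: from `c`, the machine halts in time at most `t`, whatever the choices and
samples are. Sampling a circuit with `n` qubits and `T` layers takes time `1 + n T`, everything else
takes time `1` per step. -/
inductive HaltsWithin (O : Oracle) : ℕ → M.Cfg → Prop
  | halted {t : ℕ} {c : M.Cfg} {b : Bool} : M.next O c = .halted b → HaltsWithin O t c
  | step {t : ℕ} {c c' : M.Cfg} :
      M.next O c = .step c' → HaltsWithin O t c' → HaltsWithin O (t + 1) c
  | choose {t : ℕ} {c : M.Cfg} {f : Bool → M.Cfg} :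
      M.next O c = .choose f → (∀ b, HaltsWithin O t (f b)) → HaltsWithin O (t + 1) c
  | sample {t : ℕ} {c : M.Cfg} {C : Circuit M.G} {f : (Fin C.qubits → Bool) → M.Cfg} :
      M.next O c = .sample C f → (∀ s, HaltsWithin O t (f s)) →
        HaltsWithin O (t + (1 + C.qubits * C.layers.length)) c

/-- The probability that the machine, started from a given configuration, halts after at most `t`
steps with output `b`, when choices are fair coin flips and the device has noise rate `lam`. -/
noncomputable def outputProb (O : Oracle) (lam : ℕ → ℝ) (b : Bool) : ℕ → M.Cfg → ℝ
  | 0, c =>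
    match M.next O c with
    | .halted b' => if b' = b then 1 else 0
    | _ => 0
  | t + 1, c =>
    match M.next O c with
    | .halted b' => if b' = b then 1 else 0
    | .step c' => outputProb O lam b t c'
    | .choose f => (outputProb O lam b t (f false) + outputProb O lam b t (f true)) / 2
    | .sample C f => ∑ s, C.outputProb O lam s * outputProb O lam b t (f s)

/-- The machine never calls the quantum device: it is an ordinary (probabilistic or nondeterministic)
oracle Turing machine. -/
def DeviceFree : Prop := ∀ l l', M.code l ≠ .device l'

/-- Some computation path from the given configuration halts with output `1`. -/
inductive Accepts (O : Oracle) : M.Cfg → Prop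
  | halted {c : M.Cfg} : M.next O c = .halted true → Accepts O c
  | step {c c' : M.Cfg} : M.next O c = .step c' → Accepts O c' → Accepts O c
  | choose {c : M.Cfg} {f : Bool → M.Cfg} (b : Bool) :
      M.next O c = .choose f → Accepts O (f b) → Accepts O c
  | sample {c : M.Cfg} {C : Circuit M.G} {f : (Fin C.qubits → Bool) → M.Cfg}
      (s : Fin C.qubits → Bool) :
      M.next O c = .sample C f → Accepts O (f s) → Accepts O c

end Machine

/-! ## The complexity classes -/

/-- The class `BQP_lam` relative to `O`: languages decided with error probability at most `1/3` by
polynomial-time probabilistic Turing machines with access to `O` and to `lam`-noisy quantum circuits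
that can themselves query `O`. -/
def BQPNoisy (lam : ℕ → ℝ) (O : Oracle) : Set (Language Bool) :=
  {L | ∃ (M : Machine) (p : Polynomial ℕ), ∀ x : List Bool,
    M.HaltsWithin O (p.eval x.length) (M.init x) ∧
    (x ∈ L → 2 / 3 ≤ M.outputProb O lam true (p.eval x.length) (M.init x)) ∧
    (x ∉ L → 2 / 3 ≤ M.outputProb O lam false (p.eval x.length) (M.init x))}

/-- The class `NP` relative to `O`: languages accepted by polynomial-time nondeterministic Turing
machines with access to `O`. -/
def NPOracle (O : Oracle) : Set (Language Bool) :=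
  {L | ∃ (M : Machine) (p : Polynomial ℕ), M.DeviceFree ∧ ∀ x : List Bool,
    M.HaltsWithin O (p.eval x.length) (M.init x) ∧
    (x ∈ L ↔ M.Accepts O (M.init x))}

/-! ## The Deutsch–Jozsa problem for an oracle -/

/-- The Deutsch–Jozsa promise: for every `n`, the restriction of `O` to `n`-bit strings is either
identically `0` or balanced. -/
def DeutschJozsaPromise (O : Oracle) : Prop :=
  ∀ n : ℕ, (∀ x : List Bool, x.length = n → O x = false) ∨
    2 * {x : List Bool | x.length = n ∧ O x = true}.ncard = 2 ^ n

/-- The Deutsch–Jozsa language of `O`: all `1ⁿ` such that `O` is identically `0` on `n`-bit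
strings. -/
def deutschJozsaLanguage (O : Oracle) : Language Bool :=
  {w | ∃ n : ℕ, w = List.replicate n true ∧ ∀ x : List Bool, x.length = n → O x = false}

end NoisyQuantum

/-! The upper bound needs no quantum computation. Under the promise, `O` on length `n` is either
zero or equal to `1` on half of the words. A machine that queries two independent uniform `n`-bit
words and accepts when both answers are `0` accepts a zero restriction with certainty and rejects a
balanced one with probability `3/4`. It never calls the device, so membership in `BQPNoisy` holds
for every noise rate and every promise oracle
(`DeutschJozsaPromise.deutschJozsaLanguage_mem_BQPNoisy`). The noise rate in the final theorem is
therefore arbitrary.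

The lower bound is a certificate argument followed by a diagonalisation. An accepting path of length
at most `t` looks at no more than `t` oracle values, so it survives every change of the oracle
elsewhere (`HaltsWithin.exists_certificate`). If such a path exists for an oracle that vanishes on
length `n`, and `t ≤ 2 ^ (n - 1)`, the oracle can be made balanced on length `n` without touching
the certificate; the machine then accepts wrongly.

To defeat all machines with one oracle they must be countable up to equivalence. `Machine`
quantifies over arbitrary finite types and gate sets, so device-free machines are first replaced by
numerical codes with the same accepted words relative to every oracle
(`Machine.DeviceFree.exists_numMachine`). The codes carry no time bound. Instead, `Errs` pairs an
acceptance predicate with a polynomial bounding certificate size: the predicate fails either by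
having no small certificate on a zero length or by accepting on a nonzero one.
`exists_extension_errs` forces one such failure by fixing the oracle on finitely many lengths, and
`exists_oracle_errs` iterates this over all pairs of a code and a polynomial. -/

namespace NoisyQuantum

/-! ### Certificates for accepting computations -/

namespace Machine

variable {M : Machine}

/-- One step of a machine depends on the oracle only through its value at the word on the query
stack. -/
theorem next_congr {O O' : Oracle} (c : M.Cfg)
    (h : O' (c.stk (.inl .query)) = O (c.stk (.inl .query))) : M.next O' c = M.next O c := by
  rcases c with ⟨_ | l, v, S⟩
  · rfl
  · change O' (S (.inl .query)) = O (S (.inl .query)) at h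
    unfold next
    rcases hl : M.code l with q | f | f | l' <;> simp [hl, h]

/-- An accepting computation of a machine that halts in time `t` is certified by at most `t` values
of the oracle. -/
theorem HaltsWithin.exists_certificate {O : Oracle} {t : ℕ} {c : M.Cfg}
    (h : M.HaltsWithin O t c) (ha : M.Accepts O c) :
    ∃ Q : Finset (List Bool), Q.card ≤ t ∧
      ∀ O' : Oracle, (∀ q ∈ Q, O' q = O q) → M.Accepts O' c := by
  classical
  induction h with
  | @halted t c b h =>
    by_cases hc : ∃ l, c.l = some l
    · rcases c with ⟨_ | l, v, S⟩
      · simp at hc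
      · unfold next at h
        rcases hl : M.code l with q | f | f | l' <;> simp [hl] at h
        split_ifs at h
    · rcases c with ⟨_ | l, v, S⟩
      · refine ⟨∅, by simp, fun O' _ => ?_⟩
        cases ha with
        | halted h' => exact .halted h'
        | step h' _ => simp [next] at h'
        | choose _ h' _ => simp [next] at h'
        | sample _ h' _ => simp [next] at h'
      · simp at hc
  | @step t c c' h _ ih =>
    cases ha with
    | halted h' => simp [h] at h'
    | choose _ h' _ => simp [h] at h'
    | sample _ h' _ => simp [h] at h'
    | step h' ha =>
      rw [h] at h'
      cases h'
      obtain ⟨Q, hQ, hQ'⟩ := ih ha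
      -- The word on the query stack is recorded at every step, whether or not it is queried; this
      -- costs one element per unit of time and lets `next_congr` apply uniformly.
      refine ⟨insert (c.stk (.inl .query)) Q, (Finset.card_insert_le _ _).trans (by omega),
        fun O' hO' => ?_⟩
      refine .step ((next_congr c (hO' _ (Finset.mem_insert_self _ _))).trans h) ?_
      exact hQ' O' fun q hq => hO' q (Finset.mem_insert_of_mem hq)
  | @choose t c f h _ ih =>
    cases ha with
    | halted h' => simp [h] at h'
    | step h' _ => simp [h] at h'
    | sample _ h' _ => simp [h] at h'
    | choose b h' ha =>
      rw [h] at h'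
      cases h'
      obtain ⟨Q, hQ, hQ'⟩ := ih b ha
      refine ⟨insert (c.stk (.inl .query)) Q, (Finset.card_insert_le _ _).trans (by omega),
        fun O' hO' => ?_⟩
      refine .choose b ((next_congr c (hO' _ (Finset.mem_insert_self _ _))).trans h) ?_
      exact hQ' O' fun q hq => hO' q (Finset.mem_insert_of_mem hq)
  | @sample t c C f h _ ih =>
    cases ha with
    | halted h' => simp [h] at h'
    | step h' _ => simp [h] at h'
    | choose _ h' _ => simp [h] at h'
    | sample s h' ha =>
      rw [h] at h'
      cases h'
      obtain ⟨Q, hQ, hQ'⟩ := ih s ha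
      -- The circuit may query `O`, but the set of possible successors does not depend on the
      -- sampling probabilities; the summand `1` in the cost of a sample pays for the new element.
      refine ⟨insert (c.stk (.inl .query)) Q, (Finset.card_insert_le _ _).trans (by omega),
        fun O' hO' => ?_⟩
      refine .sample s ((next_congr c (hO' _ (Finset.mem_insert_self _ _))).trans h) ?_
      exact hQ' O' fun q hq => hO' q (Finset.mem_insert_of_mem hq)

end Machine

/-! ## Numerical codes of machines without a quantum device -/

/-- Instruction sequences with stacks, symbols, labels and states named by numbers. -/
inductive Instr : Type
  | push (k : ℕ) (f : ℕ →₀ ℕ) (q : Instr)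
  | peek (k : ℕ) (f : ℕ × Option ℕ →₀ ℕ) (q : Instr)
  | pop (k : ℕ) (f : ℕ × Option ℕ →₀ ℕ) (q : Instr)
  | load (f : ℕ →₀ ℕ) (q : Instr)
  | branch (s : Finset ℕ) (q₁ q₂ : Instr)
  | goto (f : ℕ →₀ ℕ)
  | halt

/-- A tagged iterated pairing is a Gödel numbering, because all tables in instructions are finitely
supported functions or finite sets and hence countable in number. -/
instance : Countable Instr := by
  obtain ⟨a, ha⟩ := exists_injective_nat (ℕ →₀ ℕ)
  obtain ⟨b, hb⟩ := exists_injective_nat (ℕ × Option ℕ →₀ ℕ)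
  obtain ⟨c, hc⟩ := exists_injective_nat (Finset ℕ)
  let code : Instr → ℕ := fun i => Instr.rec
    (fun k f _ n => Nat.pair 0 (Nat.pair k (Nat.pair (a f) n)))
    (fun k f _ n => Nat.pair 1 (Nat.pair k (Nat.pair (b f) n)))
    (fun k f _ n => Nat.pair 2 (Nat.pair k (Nat.pair (b f) n)))
    (fun f _ n => Nat.pair 3 (Nat.pair (a f) n))
    (fun s _ _ m n => Nat.pair 4 (Nat.pair (c s) (Nat.pair m n)))
    (fun f => Nat.pair 5 (a f))
    (Nat.pair 6 0) i
  refine Function.Injective.countable (f := code) fun i => ?_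
  induction i <;> rintro (_ | _ | _ | _ | _ | _ | _) h <;>
    simp only [code, Nat.pair_eq_pair] at h <;> grind [Function.Injective]

/-- A label (`none` after halting), a state and stacks, all named by numbers. -/
abbrev NumCfg : Type := Option ℕ × ℕ × (ℕ → List ℕ)

/-- Running an instruction sequence, as in `Turing.TM2.stepAux`. -/
def Instr.exec : Instr → ℕ → (ℕ → List ℕ) → NumCfg
  | push k f q, v, T => q.exec v (Function.update T k (f v :: T k))
  | peek k f q, v, T => q.exec (f (v, (T k).head?)) T
  | pop k f q, v, T => q.exec (f (v, (T k).head?)) (Function.update T k (T k).tail)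
  | load f q, v, T => q.exec (f v) T
  | branch s q₁ q₂, v, T => if v ∈ s then q₁.exec v T else q₂.exec v T
  | goto f, v, T => (some (f v), v, T)
  | halt, v, T => (none, v, T)

/-- Actions of a machine without a quantum device. -/
inductive NumAction : Type
  | run (q : Instr)
  | choose (a₀ a₁ : ℕ)
  | oracle (a₀ a₁ : ℕ)

instance : Countable NumAction := by
  refine Function.Injective.countable (β := Instr ⊕ ℕ × ℕ ⊕ ℕ × ℕ) (f := fun a => match a with
    | .run q => .inl q
    | .choose a₀ a₁ => .inr (.inl (a₀, a₁))
    | .oracle a₀ a₁ => .inr (.inr (a₀, a₁))) ?_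
  rintro (_ | _ | _) (_ | _ | _) h <;> simp at h ⊢ <;> exact h

/-- Machines without a quantum device: the program, the accepting states, the initial label and the
initial state. -/
abbrev NumMachine : Type := List NumAction × Finset ℕ × ℕ × ℕ

/-- The initial stacks on input `x`; stack `0` is the input stack. -/
def numStacks (x : List Bool) : ℕ → List ℕ
  | 0 => x.map Bool.toNat
  | _ => []

/-- Acceptance; stack `1` is the query stack. -/
inductive NumMachine.Accepts (P : NumMachine) (O : Oracle) : NumCfg → Prop
  | halted {v T} : v ∈ P.2.1 → Accepts P O (none, v, T)
  | run {l v T q} : P.1[l]? = some (.run q) → Accepts P O (q.exec v T) → Accepts P O (some l, v, T)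
  | choose {l v T a₀ a₁} (b : Bool) : P.1[l]? = some (.choose a₀ a₁) →
      Accepts P O (some (cond b a₁ a₀), v, T) → Accepts P O (some l, v, T)
  | oracle {l v T a₀ a₁} : P.1[l]? = some (.oracle a₀ a₁) →
      Accepts P O (some (cond (O ((T 1).map (· == 1))) a₁ a₀), v, Function.update T 1 []) →
        Accepts P O (some l, v, T)

/-- A function on a finite type, transported along an injection, extends to a finitely supported
function. -/
theorem exists_finsupp_comp_eq {α β : Type*} [Finite α] {e : α → β} (he : e.Injective)
    (f : α → ℕ) : ∃ g : β →₀ ℕ, ∀ a, g (e a) = f a :=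
  ⟨(Finsupp.equivFunOnFinite.symm f).embDomain ⟨e, he⟩, fun a => by
    simpa using Finsupp.embDomain_apply_self ⟨e, he⟩ (Finsupp.equivFunOnFinite.symm f) a⟩

section Encoding

variable {K : Type*} [DecidableEq K] {Γ : K → Type*} {Λ σ : Type*}
  (eK : K → ℕ) (eΓ : ∀ k, Γ k → ℕ) (eΛ : Λ → ℕ) (eσ : σ → ℕ)

/-- Numerical stacks represent given stacks. -/
def StacksRep (S : ∀ k, List (Γ k)) (T : ℕ → List ℕ) : Prop :=
  ∀ k, T (eK k) = (S k).map (eΓ k)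

/-- A numerical configuration represents a given configuration. -/
def CfgRep (c : Turing.TM2.Cfg Γ Λ σ) (d : NumCfg) : Prop :=
  d.1 = c.l.map eΛ ∧ d.2.1 = eσ c.var ∧ StacksRep eK eΓ c.stk d.2.2

variable {eK eΓ eΛ eσ}

theorem StacksRep.update (hK : eK.Injective) {S : ∀ k, List (Γ k)} {T : ℕ → List ℕ}
    (h : StacksRep eK eΓ S T) (k : K) (w : List (Γ k)) :
    StacksRep eK eΓ (Function.update S k w) (Function.update T (eK k) (w.map (eΓ k))) := by
  intro j
  by_cases hj : j = k
  · subst hj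
    simp
  · rw [Function.update_of_ne hj, Function.update_of_ne (hK.ne hj), h j]

/-- With finitely many states and symbols, every function in a statement is a finite table, so a
finitely supported function on codes reproduces it. The instruction is chosen before the state and
the stacks, so one code serves all configurations. -/
theorem exists_instr [∀ k, Finite (Γ k)] [Finite σ] (hK : eK.Injective) (hΓ : ∀ k, (eΓ k).Injective) (hσ : eσ.Injective)
    (q : Turing.TM2.Stmt Γ Λ σ) :
    ∃ i : Instr, ∀ v S T, StacksRep eK eΓ S T →
      CfgRep eK eΓ eΛ eσ (Turing.TM2.stepAux q v S) (i.exec (eσ v) T) := by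
  have hinj : ∀ k, Function.Injective
      fun a : σ × Option (Γ k) => (eσ a.1, a.2.map (eΓ k)) := by
    rintro k ⟨v, a⟩ ⟨v', a'⟩ h
    simp only [Prod.mk.injEq] at h
    exact Prod.ext (hσ h.1) (Option.map_injective (hΓ k) h.2)
  have hhead : ∀ {S : ∀ k, List (Γ k)} {T : ℕ → List ℕ}, StacksRep eK eΓ S T →
      ∀ k, (T (eK k)).head? = (S k).head?.map (eΓ k) := by
    intro S T h k
    rw [h k, List.head?_map]
  induction q with
  | push k f q ih =>
    obtain ⟨i, hi⟩ := ih
    obtain ⟨g, hg⟩ := exists_finsupp_comp_eq hσ fun v => eΓ k (f v)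
    refine ⟨.push (eK k) g i, fun v S T h => ?_⟩
    have := hi v _ _ (h.update hK k (f v :: S k))
    simpa [Instr.exec, Turing.TM2.stepAux, hg, h k] using this
  | peek k f q ih =>
    obtain ⟨i, hi⟩ := ih
    obtain ⟨g, hg⟩ := exists_finsupp_comp_eq (hinj k) fun a => eσ (f a.1 a.2)
    refine ⟨.peek (eK k) g i, fun v S T h => ?_⟩
    have := hi (f v (S k).head?) _ _ h
    simpa only [Instr.exec, Turing.TM2.stepAux, hhead h, hg (v, (S k).head?)] using this
  | pop k f q ih =>
    obtain ⟨i, hi⟩ := ih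
    obtain ⟨g, hg⟩ := exists_finsupp_comp_eq (hinj k) fun a => eσ (f a.1 a.2)
    refine ⟨.pop (eK k) g i, fun v S T h => ?_⟩
    have := hi (f v (S k).head?) _ _ (h.update hK k (S k).tail)
    rw [List.map_tail, ← h k] at this
    simpa only [Instr.exec, Turing.TM2.stepAux, hhead h, hg (v, (S k).head?)] using this
  | load f q ih =>
    obtain ⟨i, hi⟩ := ih
    obtain ⟨g, hg⟩ := exists_finsupp_comp_eq hσ fun v => eσ (f v)
    refine ⟨.load g i, fun v S T h => ?_⟩
    simpa only [Instr.exec, Turing.TM2.stepAux, hg] using hi (f v) _ _ h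
  | branch f q₁ q₂ ih₁ ih₂ =>
    obtain ⟨i₁, hi₁⟩ := ih₁
    obtain ⟨i₂, hi₂⟩ := ih₂
    have hfin : (eσ '' {v | f v = true}).Finite := Set.toFinite _
    refine ⟨.branch hfin.toFinset i₁ i₂, fun v S T h => ?_⟩
    have hv : eσ v ∈ hfin.toFinset ↔ f v = true := by simp [hσ.eq_iff]
    simp only [Instr.exec, Turing.TM2.stepAux, hv]
    cases f v
    · simpa using hi₂ v S T h
    · simpa using hi₁ v S T h
  | goto f =>
    obtain ⟨g, hg⟩ := exists_finsupp_comp_eq hσ fun v => eΛ (f v)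
    exact ⟨.goto g, fun v S T h => ⟨by simp [Instr.exec, Turing.TM2.stepAux, hg], rfl, h⟩⟩
  | halt => exact ⟨.halt, fun v S T h => ⟨rfl, rfl, h⟩⟩

end Encoding

/-- A device-free machine may still use its circuit stack as a work stack, so this alphabet also has
to be finite for `exists_instr`. -/
instance (G : GateSet) : Finite (DeviceSymbol G) := by
  have := G.finOne
  have := G.finTwo
  refine Finite.of_surjective (α := (Fin 4 ⊕ G.One) ⊕ G.Two) (fun a => match a with
    | .inl (.inl 0) => .tick
    | .inl (.inl 1) => .mark
    | .inl (.inl 2) => .endLayer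
    | .inl (.inl 3) => .oracle
    | .inl (.inr g) => .one g
    | .inr g => .two g) ?_
  rintro (_ | _ | g | g | _ | _)
  · exact ⟨.inl (.inl 0), rfl⟩
  · exact ⟨.inl (.inl 1), rfl⟩
  · exact ⟨.inl (.inr g), rfl⟩
  · exact ⟨.inr g, rfl⟩
  · exact ⟨.inl (.inl 2), rfl⟩
  · exact ⟨.inl (.inl 3), rfl⟩

/-- A machine without a quantum device has a numerical code that accepts the same words, relative to
every oracle. -/
theorem Machine.DeviceFree.exists_numMachine {M : Machine} (hM : M.DeviceFree) :
    ∃ P : NumMachine, ∀ (O : Oracle) (x : List Bool),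
      M.Accepts O (M.init x) ↔ P.Accepts O (some P.2.2.1, P.2.2.2, numStacks x) := by
  have := M.finW
  have := M.finΓ
  have := M.finΛ
  have := M.finσ
  have : ∀ k, Finite (Alphabet M.G M.Γ k) := by
    rintro ((_ | _ | _ | _) | w)
    · exact inferInstanceAs (Finite Bool)
    · exact inferInstanceAs (Finite Bool)
    · exact inferInstanceAs (Finite (DeviceSymbol M.G))
    · exact inferInstanceAs (Finite Bool)
    · exact inferInstanceAs (Finite (M.Γ w))
  obtain ⟨eW, hW⟩ := exists_injective_nat M.W
  obtain ⟨eσ, hσ⟩ := exists_injective_nat M.σ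
  -- For labels an injection into `ℕ` is not enough: they must fill an initial segment to serve as
  -- positions in the program list.
  obtain ⟨n, ⟨eΛ⟩⟩ := Finite.exists_equiv_fin M.Λ
  choose e he using fun k => exists_injective_nat (Alphabet M.G M.Γ k)
  -- The values `0` and `1` are forced by `numStacks` and `NumMachine.Accepts`; work stacks are
  -- shifted past the four ports.
  let eK : Port ⊕ M.W → ℕ
    | .inl .input => 0
    | .inl .query => 1
    | .inl .circuit => 2
    | .inl .sample => 3
    | .inr w => eW w + 4
  let eΓ : ∀ k, Alphabet M.G M.Γ k → ℕ
    | .inl .input => Bool.toNat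
    | .inl .query => Bool.toNat
    | .inl .circuit => e _
    | .inl .sample => e _
    | .inr w => e _
  have hK : eK.Injective := by
    rintro ((_ | _ | _ | _) | w) ((_ | _ | _ | _) | w') h <;> simp [eK] at h ⊢
    exact hW h
  have hb : Function.Injective Bool.toNat := by decide
  have hΓ : ∀ k, (eΓ k).Injective := by
    rintro ((_ | _ | _ | _) | w)
    · exact hb
    · exact hb
    · exact he _
    · exact he _
    · exact he _
  have hact : ∀ l, ∃ a : NumAction, match M.code l with
      | .run q => ∃ i : Instr, a = .run i ∧ ∀ v S T, StacksRep eK eΓ S T →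
          CfgRep eK eΓ (fun l => (eΛ l : ℕ)) eσ (Turing.TM2.stepAux q v S) (i.exec (eσ v) T)
      | .choose f => a = .choose (eΛ (f false)) (eΛ (f true))
      | .oracle f => a = .oracle (eΛ (f false)) (eΛ (f true))
      | .device _ => True := by
    intro l
    rcases M.code l with q | f | f | l'
    · obtain ⟨i, hi⟩ := exists_instr (eΛ := fun l => (eΛ l : ℕ)) hK hΓ hσ q
      exact ⟨.run i, i, rfl, hi⟩
    · exact ⟨_, rfl⟩
    · exact ⟨_, rfl⟩
    -- A dummy action; device labels do not occur in a device-free machine.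
    · exact ⟨.choose 0 0, trivial⟩
  choose act hact using hact
  have hfin : (eσ '' {v | M.output v = true}).Finite := Set.toFinite _
  let P : NumMachine :=
    (List.ofFn fun j => act (eΛ.symm j), hfin.toFinset, eΛ M.main, eσ M.start)
  have hP : ∀ l, P.1[(eΛ l : ℕ)]? = some (act l) := by
    intro l
    simp [P]
  have hout : ∀ v, eσ v ∈ P.2.1 ↔ M.output v = true := by
    intro v
    simp [P, hσ.eq_iff]
  have hquery : ∀ {S : ∀ k, List (Alphabet M.G M.Γ k)} {T : ℕ → List ℕ}, StacksRep eK eΓ S T →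
      (T 1).map (· == 1) = S (.inl .query) := by
    intro S T h
    have h1 : T 1 = List.map Bool.toNat (S (.inl .query)) := h (.inl .query)
    have h2 : ∀ w : List Bool, (w.map Bool.toNat).map (· == 1) = w := by
      intro w
      induction w with
      | nil => rfl
      | cons b w ih => cases b <;> simp [ih]
    rw [h1]
    exact h2 (S (.inl .query))
  refine ⟨P, fun O x => ?_⟩
  have hinit : CfgRep eK eΓ (fun l => (eΛ l : ℕ)) eσ (M.init x)
      (some P.2.2.1, P.2.2.2, numStacks x) := by
    refine ⟨rfl, rfl, ?_⟩
    rintro ((_ | _ | _ | _) | w) <;> rfl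
  constructor
  · intro h
    have key : ∀ (c : M.Cfg) (d : NumCfg), M.Accepts O c →
        CfgRep eK eΓ (fun l => (eΛ l : ℕ)) eσ c d → P.Accepts O d := by
      intro c d hc
      induction hc generalizing d with
      | @halted c h =>
        rcases c with ⟨_ | l, v, S⟩ <;> rintro ⟨h1, h2, h3⟩ <;>
          obtain ⟨d1, d2, T⟩ := d <;> simp only at h1 h2 h3 <;> subst h1 h2
        · simp only [next, Next.halted.injEq] at h
          exact .halted ((hout v).2 h)
        · unfold next at h
          rcases hl : M.code l with q | f | f | l' <;> simp [hl] at h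
          split_ifs at h
      | @step c c' h _ ih =>
        rcases c with ⟨_ | l, v, S⟩ <;> rintro ⟨h1, h2, h3⟩ <;>
          obtain ⟨d1, d2, T⟩ := d <;> simp only at h1 h2 h3 <;> subst h1 h2
        · simp [next] at h
        · have ha := hact l
          unfold next at h
          rcases hl : M.code l with q | f | f | l' <;> simp [hl] at h ha
          · obtain ⟨i, hi, hi'⟩ := ha
            subst h
            exact .run ((hP l).trans (congrArg some hi)) (ih _ (hi' v S T h3))
          · subst h
            refine .oracle ((hP l).trans (congrArg some ha)) (ih _ ⟨?_, rfl, ?_⟩)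
            · rw [hquery h3]
              simp only [Option.map_some]
              cases O (S (.inl .query)) <;> rfl
            · exact h3.update hK (.inl .query) []
          · exact absurd hl (hM l l')
      | @choose c f b h _ ih =>
        rcases c with ⟨_ | l, v, S⟩ <;> rintro ⟨h1, h2, h3⟩ <;>
          obtain ⟨d1, d2, T⟩ := d <;> simp only at h1 h2 h3 <;> subst h1 h2
        · simp [next] at h
        · have ha := hact l
          unfold next at h
          rcases hl : M.code l with q | f | f | l' <;> simp [hl] at h ha
          · subst h
            refine .choose b ((hP l).trans (congrArg some ha)) (ih _ ⟨?_, rfl, h3⟩)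
            cases b <;> rfl
          · exact absurd hl (hM l l')
      | @sample c C f s h _ ih =>
        rcases c with ⟨_ | l, v, S⟩
        · simp [next] at h
        · unfold next at h
          rcases hl : M.code l with q | f | f | l' <;> simp [hl] at h
          exact absurd hl (hM l l')
    exact key _ _ h hinit
  · intro h
    have key : ∀ (d : NumCfg) (c : M.Cfg), P.Accepts O d →
        CfgRep eK eΓ (fun l => (eΛ l : ℕ)) eσ c d → M.Accepts O c := by
      intro d c hd
      induction hd generalizing c with
      | halted hv =>
        rcases c with ⟨_ | l, v, S⟩ <;> rintro ⟨h1, h2, h3⟩ <;> simp only at h1 h2 h3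
        · subst h2
          exact .halted (by simp [next, (hout v).1 hv])
        · simp at h1
      | @run l' v' T q' hl' _ ih =>
        rcases c with ⟨_ | l, v, S⟩ <;> rintro ⟨h1, h2, h3⟩ <;> simp at h1 h2 h3
        subst h1 h2
        have ha := hact l
        rw [hP l, Option.some_inj] at hl'
        rcases hl : M.code l with q | f | f | l' <;> simp [hl, hl'] at ha
        · exact .step (c' := Turing.TM2.stepAux q v S) (by simp [next, hl]) (ih _ (ha v S T h3))
        · exact absurd hl (hM l l')
      | @choose l' v' T a₀ a₁ b hl' _ ih =>
        rcases c with ⟨_ | l, v, S⟩ <;> rintro ⟨h1, h2, h3⟩ <;> simp at h1 h2 h3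
        subst h1 h2
        have ha := hact l
        rw [hP l, Option.some_inj] at hl'
        rcases hl : M.code l with q | f | f | l' <;> simp [hl, hl'] at ha
        · obtain ⟨rfl, rfl⟩ := ha
          refine .choose (f := fun b => ⟨some (f b), v, S⟩) b (by simp [next, hl])
            (ih _ ⟨?_, rfl, h3⟩)
          cases b <;> rfl
        · exact absurd hl (hM l l')
      | @oracle l' v' T a₀ a₁ hl' _ ih =>
        rcases c with ⟨_ | l, v, S⟩ <;> rintro ⟨h1, h2, h3⟩ <;> simp at h1 h2 h3
        subst h1 h2
        have ha := hact l
        rw [hP l, Option.some_inj] at hl'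
        rcases hl : M.code l with q | f | f | l' <;> simp [hl, hl'] at ha
        · obtain ⟨rfl, rfl⟩ := ha
          refine .step (c' := ⟨some (f (O (S (.inl .query)))), v,
            Function.update S (.inl .query) []⟩) (by simp [next, hl]) (ih _ ⟨?_, rfl, ?_⟩)
          · rw [hquery h3]
            simp only [Option.map_some]
            cases O (S (.inl .query)) <;> rfl
          · exact h3.update hK (.inl .query) []
        · exact absurd hl (hM l l')
    exact key _ _ h hinit

/-! ### Diagonalisation over countably many acceptance predicates -/

/-- Every polynomial is eventually bounded by `n ↦ 2 ^ (n - 1)`. -/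
theorem exists_eval_le_two_pow (p : Polynomial ℕ) (m : ℕ) :
    ∃ n, m ≤ n ∧ 1 ≤ n ∧ p.eval n ≤ 2 ^ (n - 1) := by
  have key : (fun n : ℕ => ((p.eval n : ℕ) : ℝ)) =o[Filter.atTop] fun n => (2 : ℝ) ^ n := by
    induction p using Polynomial.induction_on' with
    | add p q hp hq => simpa using hp.add hq
    | monomial k a =>
      simpa using (isLittleO_pow_const_const_pow_of_one_lt (R := ℝ) k one_lt_two).const_mul_left
        (a : ℝ)
  -- The little-o constant `1/2` turns the bound `2 ^ n` into `2 ^ (n - 1)`.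
  obtain ⟨n, hn, hmn⟩ := ((key.bound (one_half_pos (α := ℝ))).and
    (Filter.eventually_ge_atTop (max m 1))).exists
  have h1 : 1 ≤ n := le_trans (le_max_right _ _) hmn
  refine ⟨n, le_trans (le_max_left _ _) hmn, h1, ?_⟩
  obtain ⟨k, rfl⟩ : ∃ k, n = k + 1 := ⟨n - 1, by omega⟩
  have h2 : ((p.eval (k + 1) : ℕ) : ℝ) ≤ 2 ^ k := by
    simp only [Real.norm_natCast, pow_succ, norm_mul, norm_pow, Real.norm_ofNat] at hn
    linarith
  exact_mod_cast h2

/-- Outside a set of at most half of all `n`-bit strings there is a set of exactly half of all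
`n`-bit strings. -/
theorem exists_balanced_disjoint {n : ℕ} (hn : 1 ≤ n) (Q : Finset (List Bool))
    (hQ : Q.card ≤ 2 ^ (n - 1)) :
    ∃ H : Finset (List Bool), H.card = 2 ^ (n - 1) ∧ (∀ x ∈ H, x.length = n) ∧ Disjoint H Q := by
  classical
  have hinj : Function.Injective (List.Vector.toList : List.Vector Bool n → List Bool) :=
    List.Vector.toList_injective
  let A : Finset (List Bool) := Finset.univ.map ⟨_, hinj⟩
  have hA : A.card = 2 ^ n := by simp [A]
  have h2 : 2 ^ n = 2 * 2 ^ (n - 1) := by rw [← pow_succ', Nat.sub_add_cancel hn]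
  have hcard : 2 ^ (n - 1) ≤ (A \ Q).card := by
    have := Finset.le_card_sdiff Q A
    omega
  obtain ⟨H, hH, hHc⟩ := Finset.exists_subset_card_eq hcard
  refine ⟨H, hHc, fun x hx => ?_, Finset.disjoint_left.2 fun x hx => (Finset.mem_sdiff.1 (hH hx)).2⟩
  obtain ⟨v, -, rfl⟩ := Finset.mem_map.1 (Finset.mem_sdiff.1 (hH hx)).1
  exact v.toList_length

/-- The part of an acceptance predicate that is certified by at most `t` oracle values. -/
def Certified (B : Oracle → ℕ → Prop) (t : ℕ) (O : Oracle) (n : ℕ) : Prop :=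
  ∃ Q : Finset (List Bool), Q.card ≤ t ∧ ∀ O' : Oracle, (∀ q ∈ Q, O' q = O q) → B O' n

/-- The predicate `B` with certificates of size `p n` errs on the Deutsch–Jozsa problem for `O`. -/
def Errs (B : Oracle → ℕ → Prop) (p : Polynomial ℕ) (O : Oracle) : Prop :=
  ∃ n, ((∀ x : List Bool, x.length = n → O x = false) ∧ ¬ Certified B (p.eval n) O n) ∨
    (¬ (∀ x : List Bool, x.length = n → O x = false) ∧ B O n)

/-- Redefining a promise oracle on one length, by zero or in a balanced way, keeps the promise. -/
theorem DeutschJozsaPromise.piecewise {O : Oracle} (hO : DeutschJozsaPromise O) (n : ℕ)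
    (H : Finset (List Bool)) (hH : ∀ x ∈ H, x.length = n) (hc : H = ∅ ∨ 2 * H.card = 2 ^ n) :
    DeutschJozsaPromise fun x => if x.length = n then decide (x ∈ H) else O x := by
  intro k
  by_cases hk : k = n
  · subst hk
    rcases hc with rfl | hc
    · left
      intro x hx
      simp [hx]
    · right
      rw [← hc, ← Set.ncard_coe_finset]
      congr 2
      ext x
      constructor
      · rintro ⟨hx, hx'⟩
        simpa [hx] using hx'
      · intro hx
        exact ⟨hH x hx, by simpa [hH x hx] using hx⟩
  · rcases hO k with h | h
    · left
      intro x hx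
      simp [hx, hk, h x hx]
    · right
      rw [← h]
      congr 2
      ext x
      constructor
      · rintro ⟨hx, hx'⟩
        exact ⟨hx, by simpa [hx, hk] using hx'⟩
      · rintro ⟨hx, hx'⟩
        exact ⟨hx, by simpa [hx, hk] using hx'⟩

/-- Any promise oracle can be changed on long words so that a given predicate errs, whatever is
changed later on even longer words. -/
theorem exists_extension_errs (B : Oracle → ℕ → Prop) (p : Polynomial ℕ) {O : Oracle}
    (hO : DeutschJozsaPromise O) (m : ℕ) :
    ∃ O₁ m₁, m < m₁ ∧ DeutschJozsaPromise O₁ ∧ (∀ x, x.length < m → O₁ x = O x) ∧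
      ∀ O₂, DeutschJozsaPromise O₂ → (∀ x, x.length < m₁ → O₂ x = O₁ x) → Errs B p O₂ := by
  classical
  obtain ⟨n, hmn, hn, hp⟩ := exists_eval_le_two_pow p m
  -- The case distinction ranges over all promise oracles compatible with what is fixed below `m`,
  -- so in the negative case no later extension that is zero on length `n` can acquire a
  -- certificate.
  by_cases hex : ∃ O', DeutschJozsaPromise O' ∧ (∀ x, x.length < m → O' x = O x) ∧
      (∀ x, x.length = n → O' x = false) ∧ Certified B (p.eval n) O' n
  · obtain ⟨O', hO', hagree, hzero, Q, hQ, hB⟩ := hex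
    obtain ⟨H, hHc, hHn, hHQ⟩ := exists_balanced_disjoint hn Q (hQ.trans hp)
    -- The new threshold freezes length `n` and every word of the certificate, which may contain
    -- words longer than `n`.
    refine ⟨fun x => if x.length = n then decide (x ∈ H) else O' x,
      max (n + 1) (Q.sup List.length + 1), by omega, hO'.piecewise n H hHn (.inr ?_), ?_, ?_⟩
    · rw [hHc, ← pow_succ', Nat.sub_add_cancel hn]
    · intro x hx
      dsimp only
      rw [if_neg (by omega), hagree x hx]
    · intro O₂ _ h₂
      refine ⟨n, .inr ⟨fun h => ?_, hB O₂ fun q hq => ?_⟩⟩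
      · obtain ⟨x, hx⟩ : H.Nonempty := Finset.card_pos.1 (by rw [hHc]; positivity)
        have h1 := h₂ x (by rw [hHn x hx]; omega)
        dsimp only at h1
        rw [h x (hHn x hx), if_pos (hHn x hx)] at h1
        simp [hx] at h1
      · have hlen : q.length ≤ Q.sup List.length := Finset.le_sup hq
        rw [h₂ q (by omega)]
        dsimp only
        by_cases hqn : q.length = n
        -- Certificate words of length `n` lie outside `H`, so they keep the value `0` that they had
        -- under `O'`.
        · rw [if_pos hqn, hzero q hqn]
          simpa using Finset.disjoint_right.1 hHQ hq
        · rw [if_neg hqn]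
  · refine ⟨fun x => if x.length = n then decide (x ∈ (∅ : Finset (List Bool))) else O x, n + 1,
      by omega, hO.piecewise n ∅ (by simp) (.inl rfl), ?_, ?_⟩
    · intro x hx
      exact if_neg (by omega)
    · intro O₂ hP₂ h₂
      have hz : ∀ x : List Bool, x.length = n → O₂ x = false := by
        intro x hx
        simp [h₂ x (by omega), hx]
      -- If `O₂` had a certificate, `O₂` itself would be the oracle excluded by the case assumption.
      refine ⟨n, .inl ⟨hz, fun hcert => hex ⟨O₂, hP₂, fun x hx => ?_, hz, hcert⟩⟩⟩
      exact (h₂ x (by omega)).trans (if_neg (by omega))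

/-- For countably many predicates there is one promise oracle on which all of them err. -/
theorem exists_oracle_errs (B : ℕ → Oracle → ℕ → Prop) (p : ℕ → Polynomial ℕ) :
    ∃ O, DeutschJozsaPromise O ∧ ∀ i, Errs (B i) (p i) O := by
  let C : Type := {c : Oracle × ℕ // DeutschJozsaPromise c.1}
  have hstep : ∀ (i : ℕ) (c : C), ∃ c' : C, c.1.2 < c'.1.2 ∧
      (∀ x, x.length < c.1.2 → c'.1.1 x = c.1.1 x) ∧
      ∀ O₂, DeutschJozsaPromise O₂ → (∀ x, x.length < c'.1.2 → O₂ x = c'.1.1 x) →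
        Errs (B i) (p i) O₂ := by
    rintro i ⟨⟨O, m⟩, hO⟩
    obtain ⟨O₁, m₁, h1, h2, h3, h4⟩ := exists_extension_errs (B i) (p i) hO m
    exact ⟨⟨(O₁, m₁), h2⟩, h1, h3, h4⟩
  choose f hlt hagree herr using hstep
  let s : ℕ → C := fun i => Nat.rec ⟨(fun _ => false, 0), fun _ => .inl fun _ _ => rfl⟩ f i
  have hs : ∀ i, s (i + 1) = f i (s i) := fun _ => rfl
  have hmono : StrictMono fun i => (s i).1.2 :=
    strictMono_nat_of_lt_succ fun i => by
      simp only [hs]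
      exact hlt i (s i)
  have hstable : ∀ i j, i ≤ j → ∀ x : List Bool, x.length < (s i).1.2 →
      (s j).1.1 x = (s i).1.1 x := by
    intro i j hij
    induction j, hij using Nat.le_induction with
    | base => exact fun _ _ => rfl
    | succ j hij ih =>
      intro x hx
      rw [hs, hagree j (s j) x (hx.trans_le (hmono.monotone hij)), ih x hx]
  -- Thresholds increase strictly, so the one at stage `x.length + 1` exceeds `x.length` and the
  -- value at `x` is final from that stage on.
  let O : Oracle := fun x => (s (x.length + 1)).1.1 x
  have hO : ∀ i (x : List Bool), x.length < (s i).1.2 → O x = (s i).1.1 x := by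
    intro i x hx
    have hx' : x.length < (s (x.length + 1)).1.2 := hmono.le_apply
    rcases le_total i (x.length + 1) with h | h
    · exact hstable _ _ h x hx
    · exact (hstable _ _ h x hx').symm
  have hprom : DeutschJozsaPromise O := by
    intro n
    have heq : ∀ x : List Bool, x.length = n → O x = (s (n + 1)).1.1 x := by
      intro x hx
      subst hx
      rfl
    rcases (s (n + 1)).2 n with h | h
    · exact .inl fun x hx => (heq x hx).trans (h x hx)
    · right
      rw [← h]
      congr 2
      ext x
      exact and_congr_right fun hx => by rw [heq x hx]
  refine ⟨O, hprom, fun i => herr i (s i) O hprom fun x hx => ?_⟩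
  rw [← hs] at hx ⊢
  exact hO (i + 1) x hx

/-- Needed to enumerate pairs of a machine code and a polynomial bound. -/
theorem countable_natPolynomial : Countable (Polynomial ℕ) := by
  refine Function.Injective.countable (f := fun p : Polynomial ℕ => p.toFinsupp.coeff) ?_
  exact AddMonoidAlgebra.coeff_injective.comp Polynomial.toFinsupp_injective

/-! ### Unfolding time bounds and output probabilities -/

namespace Machine

variable {M : Machine} {O : Oracle}

theorem HaltsWithin.mono {t t' : ℕ} {c : M.Cfg} (h : M.HaltsWithin O t c) (htt' : t ≤ t') :
    M.HaltsWithin O t' c := by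
  induction h generalizing t' with
  | halted h => exact .halted h
  | step h _ ih =>
    obtain ⟨s, rfl⟩ := Nat.exists_eq_add_of_le' (Nat.le_of_add_left_le htt')
    exact .step h (ih (by omega))
  | choose h _ ih =>
    obtain ⟨s, rfl⟩ := Nat.exists_eq_add_of_le' (Nat.le_of_add_left_le htt')
    exact .choose h fun b => ih b (by omega)
  | @sample t c C f h _ ih =>
    obtain ⟨s, rfl⟩ := Nat.exists_eq_add_of_le'
      ((Nat.le_add_left (1 + C.qubits * C.layers.length) t).trans htt')
    exact .sample h fun b => ih b (by omega)

variable {lam : ℕ → ℝ} {b : Bool}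

theorem outputProb_halted {t : ℕ} {c : M.Cfg} {b' : Bool} (h : M.next O c = .halted b') :
    M.outputProb O lam b t c = if b' = b then 1 else 0 := by
  cases t <;> simp [outputProb, h]

theorem outputProb_step {t : ℕ} {c c' : M.Cfg} (h : M.next O c = .step c') :
    M.outputProb O lam b (t + 1) c = M.outputProb O lam b t c' := by
  simp [outputProb, h]

theorem outputProb_choose {t : ℕ} {c : M.Cfg} {f : Bool → M.Cfg} (h : M.next O c = .choose f) :
    M.outputProb O lam b (t + 1) c =
      (M.outputProb O lam b t (f false) + M.outputProb O lam b t (f true)) / 2 := by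
  simp [outputProb, h]

end Machine

/-! ### Averages over random words -/

/-- The mean of `f (y ++ q)` over all `m`-bit strings `y`. -/
noncomputable def bitAverage (f : List Bool → ℝ) : ℕ → List Bool → ℝ
  | 0, q => f q
  | m + 1, q => (bitAverage f m (false :: q) + bitAverage f m (true :: q)) / 2

theorem bitAverage_eq_const {f : List Bool → ℝ} {a : ℝ} {m : ℕ} {q : List Bool}
    (h : ∀ y : List Bool, y.length = m + q.length → f y = a) : bitAverage f m q = a := by
  induction m generalizing q with
  | zero => exact h q (by simp)
  | succ m ih =>
    have := fun b => ih (q := b :: q) fun y hy => h y (by simp at hy; omega)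
    simp [bitAverage, this]

/-- The mean of a function with two values. -/
theorem bitAverage_ite (O : Oracle) (a₁ a₀ : ℝ) (m : ℕ) (q : List Bool) :
    bitAverage (fun y => if O y = true then a₁ else a₀) m q =
      a₀ + (a₁ - a₀) * ({x | (x.length = m + q.length ∧ q <:+ x) ∧ O x = true}.ncard / 2 ^ m) := by
  induction m generalizing q with
  | zero =>
    have h : ∀ x : List Bool, (x.length = 0 + q.length ∧ q <:+ x) ↔ x = q := by
      refine fun x => ⟨fun h => (h.2.eq_of_length (by omega)).symm, ?_⟩
      rintro rfl
      simp
    simp only [bitAverage, h]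
    by_cases hq : O q = true
    · have : {x | x = q ∧ O x = true} = {q} := by
        ext x
        simp +contextual [hq]
      simp [this, hq]
    · have : {x | x = q ∧ O x = true} = ∅ := by
        ext x
        simp +contextual [hq]
      simp [this, hq]
  | succ m ih =>
    have hunion : {x | (x.length = m + 1 + q.length ∧ q <:+ x) ∧ O x = true} =
        {x | (x.length = m + (false :: q).length ∧ (false :: q) <:+ x) ∧ O x = true} ∪
          {x | (x.length = m + (true :: q).length ∧ (true :: q) <:+ x) ∧ O x = true} := by
      ext x
      simp only [Set.mem_ofPred_eq, Set.mem_union, List.length_cons]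
      constructor
      · rintro ⟨⟨hl, y, rfl⟩, hO⟩
        rcases List.eq_nil_or_concat' y with rfl | ⟨y, b, rfl⟩
        · simp at hl
        · have hl' : (y ++ [b] ++ q).length = m + (q.length + 1) := by
            simp only [List.length_append, List.length_cons, List.length_nil] at hl ⊢
            omega
          cases b
          · exact .inl ⟨⟨hl', y, by simp⟩, hO⟩
          · exact .inr ⟨⟨hl', y, by simp⟩, hO⟩
      · rintro (⟨⟨hl, hs⟩, hO⟩ | ⟨⟨hl, hs⟩, hO⟩) <;>
          exact ⟨⟨by omega, (List.suffix_cons _ _).trans hs⟩, hO⟩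
    have hfin : ∀ (n : ℕ) (P : List Bool → Prop),
        {x : List Bool | (x.length = n ∧ P x) ∧ O x = true}.Finite := fun n P =>
      (List.finite_length_eq Bool n).subset fun x hx => hx.1.1
    have hdisj : Disjoint
        {x | (x.length = m + (false :: q).length ∧ (false :: q) <:+ x) ∧ O x = true}
        {x | (x.length = m + (true :: q).length ∧ (true :: q) <:+ x) ∧ O x = true} := by
      -- Two suffixes of the same word with equal length coincide, which here would identify `false`
      -- with `true`.
      refine Set.disjoint_left.2 fun x h₁ h₂ => ?_
      have := List.suffix_of_suffix_length_le h₁.1.2 h₂.1.2 (by simp)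
      simpa using this.eq_of_length (by simp)
    rw [hunion, Set.ncard_union_eq hdisj (hfin _ _) (hfin _ _), bitAverage, ih, ih]
    push_cast
    field_simp
    ring

/-! ## The sampling algorithm -/

/-- The labels of the sampling machine; the argument of the first four is the round. -/
inductive SamplerLabel : Type
  | read (second : Bool)
  | flip (second : Bool)
  | put (second b : Bool)
  | ask (second : Bool)
  | finish (b : Bool)

instance : Finite SamplerLabel := by
  refine Finite.of_injective (β := Fin 5 × Bool × Bool) (fun l => match l with
    | .read r => (0, r, false)
    | .flip r => (1, r, false)
    | .put r b => (2, r, b)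
    | .ask r => (3, r, false)
    | .finish b => (4, b, false)) ?_
  rintro (_ | _ | _ | _ | _) (_ | _ | _ | _ | _) h <;> simp at h ⊢ <;> exact h

/-- The empty gate set. -/
def GateSet.empty : GateSet where
  One := Empty
  Two := Empty
  one := Empty.elim
  two := Empty.elim
  algebraic_one := fun g => g.elim
  algebraic_two := fun g => g.elim

open Turing.TM2.Stmt in
/-- The program of the sampling machine. In the first round it reads the input, in the second round
the work stack; for every letter `1` it puts a random bit on the query stack. -/
def samplerCode : SamplerLabel →
    Action GateSet.empty (fun _ : Unit => Bool) SamplerLabel (Option Bool)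
  | .read false => .run <| pop (.inl .input) (fun _ a => a) <|
      branch (fun v => v == none) (goto fun _ => .ask false) <|
        branch (fun v => v == some true) (goto fun _ => .flip false) (goto fun _ => .finish false)
  | .read true => .run <| pop (.inr ()) (fun _ a => a) <|
      branch (fun v => v == none) (goto fun _ => .ask true) (goto fun _ => .flip true)
  | .flip r => .choose fun b => .put r b
  | .put false b => .run <| push (.inl .query) (fun _ => b) <| push (.inr ()) (fun _ => true) <|
      goto fun _ => .read false
  | .put true b => .run <| push (.inl .query) (fun _ => b) <| goto fun _ => .read true
  | .ask false => .oracle fun b => if b then .finish false else .read true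
  | .ask true => .oracle fun b => .finish !b
  | .finish b => .run <| load (fun _ => some b) halt

/-- On input `1ⁿ`, query the oracle at two random `n`-bit strings and accept if both answers are `0`;
reject all other inputs. -/
def sampler : Machine where
  G := .empty
  W := Unit
  Γ := fun _ => Bool
  Λ := SamplerLabel
  σ := Option Bool
  main := .read false
  start := none
  code := samplerCode
  output := fun v => v == some true

/-- The stacks of the sampling machine with given input, query and work stacks. -/
def samplerStacks (i q w : List Bool) :
    ∀ k : Port ⊕ Unit, List (Alphabet GateSet.empty (fun _ : Unit => Bool) k)
  | .inl .input => i
  | .inl .query => q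
  | .inl .circuit => []
  | .inl .sample => []
  | .inr _ => w

/-- A configuration of the sampling machine. -/
def samplerCfg (l : SamplerLabel) (v : Option Bool) (i q w : List Bool) : sampler.Cfg :=
  ⟨some l, v, samplerStacks i q w⟩

theorem sampler_init (x : List Bool) :
    sampler.init x = samplerCfg (.read false) none x [] [] := by
  simp only [Machine.init, samplerCfg]
  congr 1
  funext k
  rcases k with (_ | _ | _ | _) | _ <;> rfl

theorem update_input (i i' q w : List Bool) :
    Function.update (samplerStacks i q w) (.inl .input) i' = samplerStacks i' q w := by
  funext k
  rcases k with (_ | _ | _ | _) | _ <;> rfl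

theorem update_query (i q q' w : List Bool) :
    Function.update (samplerStacks i q w) (.inl .query) q' = samplerStacks i q' w := by
  funext k
  rcases k with (_ | _ | _ | _) | _ <;> rfl

theorem update_work (i q w w' : List Bool) :
    Function.update (samplerStacks i q w) (.inr ()) w' = samplerStacks i q w' := by
  funext k
  rcases k with (_ | _ | _ | _) | _ <;> rfl

variable {O : Oracle} {v : Option Bool} {i q w : List Bool}

theorem next_read_first_nil : sampler.next O (samplerCfg (.read false) v [] q w) =
    .step (samplerCfg (.ask false) none [] q w) :=
  congrArg Machine.Next.step <| congrArg (Turing.TM2.Cfg.mk _ _) (update_input [] [] q w)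

theorem next_read_first_cons {a : Bool} : sampler.next O (samplerCfg (.read false) v (a :: i) q w) =
    .step (samplerCfg (if a then .flip false else .finish false) (some a) i q w) := by
  cases a <;>
  exact congrArg Machine.Next.step <| congrArg (Turing.TM2.Cfg.mk _ _) (update_input _ i q w)

theorem next_read_second_nil : sampler.next O (samplerCfg (.read true) v i q []) =
    .step (samplerCfg (.ask true) none i q []) :=
  congrArg Machine.Next.step <| congrArg (Turing.TM2.Cfg.mk _ _) (update_work i q _ _)

theorem next_read_second_cons {a : Bool} : sampler.next O (samplerCfg (.read true) v i q (a :: w)) =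
    .step (samplerCfg (.flip true) (some a) i q w) := by
  cases a <;>
  exact congrArg Machine.Next.step <| congrArg (Turing.TM2.Cfg.mk _ _) (update_work i q _ _)

theorem next_flip {r : Bool} : sampler.next O (samplerCfg (.flip r) v i q w) =
    .choose fun b => samplerCfg (.put r b) v i q w := rfl

theorem next_put_first {b : Bool} : sampler.next O (samplerCfg (.put false b) v i q w) =
    .step (samplerCfg (.read false) v i (b :: q) (true :: w)) :=
  congrArg Machine.Next.step <| congrArg (Turing.TM2.Cfg.mk _ _) <|
    (congrArg (fun S : ∀ k : Port ⊕ Unit, List (Alphabet GateSet.empty (fun _ : Unit => Bool) k) =>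
        Function.update S (.inr ()) (true :: w)) (update_query i q (b :: q) w)).trans
      (update_work i (b :: q) w (true :: w))

theorem next_put_second {b : Bool} : sampler.next O (samplerCfg (.put true b) v i q w) =
    .step (samplerCfg (.read true) v i (b :: q) w) :=
  congrArg Machine.Next.step <| congrArg (Turing.TM2.Cfg.mk _ _) (update_query i q (b :: q) w)

theorem next_ask_first : sampler.next O (samplerCfg (.ask false) v i q w) =
    .step (samplerCfg (if O q then .finish false else .read true) v i [] w) :=
  congrArg Machine.Next.step <| congrArg (Turing.TM2.Cfg.mk _ _) (update_query i q [] w)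

theorem next_ask_second : sampler.next O (samplerCfg (.ask true) v i q w) =
    .step (samplerCfg (.finish !O q) v i [] w) :=
  congrArg Machine.Next.step <| congrArg (Turing.TM2.Cfg.mk _ _) (update_query i q [] w)

theorem next_finish {b : Bool} : sampler.next O (samplerCfg (.finish b) v i q w) =
    .step ⟨none, some b, samplerStacks i q w⟩ := rfl

theorem next_none {v : Option Bool} {S} : sampler.next O ⟨none, v, S⟩ = .halted (v == some true) :=
  rfl

/-! ### Running time and output distribution of the sampler -/

theorem haltsWithin_finish {b : Bool} :
    sampler.HaltsWithin O 1 (samplerCfg (.finish b) v i q w) :=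
  .step next_finish (.halted next_none)

theorem haltsWithin_second :
    sampler.HaltsWithin O (3 * w.length + 3) (samplerCfg (.read true) v i q w) := by
  induction w generalizing v q with
  | nil => exact .step next_read_second_nil (.step next_ask_second haltsWithin_finish)
  | cons a w ih =>
    exact .step next_read_second_cons (.choose next_flip fun b => .step next_put_second ih)

/-- Each input letter costs at most three steps now (read, flip, put) and three more in the second
round, since it leaves a letter on the work stack; each letter already there costs three. The
constant counts two end-of-stack reads, two queries and the final step. -/
theorem haltsWithin_first :
    sampler.HaltsWithin O (6 * i.length + 3 * w.length + 5) (samplerCfg (.read false) v i q w) := by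
  induction i generalizing v q w with
  | nil =>
    refine .step next_read_first_nil (.step next_ask_first ?_)
    split_ifs
    · exact haltsWithin_finish.mono (by simp)
    · exact haltsWithin_second.mono (by simp)
  | cons a i ih =>
    have hlen : 6 * (a :: i).length + 3 * w.length + 5 =
        6 * i.length + 3 * (true :: w).length + 5 + 1 + 1 + 1 := by
      simp only [List.length_cons]
      ring
    rw [hlen]
    refine .step next_read_first_cons ?_
    split_ifs
    · exact .choose next_flip fun b => .step next_put_first ih
    · exact haltsWithin_finish.mono (by simp)

variable {lam : ℕ → ℝ} {b : Bool} {t : ℕ}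

theorem outputProb_finish {b' : Bool} (ht : 1 ≤ t) :
    sampler.outputProb O lam b t (samplerCfg (.finish b') v i q w) = if b' = b then 1 else 0 := by
  obtain ⟨t, rfl⟩ := Nat.exists_eq_add_of_le' ht
  refine (Machine.outputProb_step next_finish).trans ((Machine.outputProb_halted next_none).trans ?_)
  cases b' <;> rfl

/-- Pushing a fair coin flip on the query stack is exactly one step of the recursion defining
`bitAverage`. -/
theorem outputProb_second (ht : 3 * w.length + 3 ≤ t) :
    sampler.outputProb O lam b t (samplerCfg (.read true) v i q w) =
      bitAverage (fun y => if (!O y) = b then 1 else 0) w.length q := by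
  induction w generalizing v q t with
  | nil =>
    obtain ⟨t, rfl⟩ := Nat.exists_eq_add_of_le' ht
    rw [List.length_nil, mul_zero, zero_add, ← Nat.add_assoc t 2 1, ← Nat.add_assoc t 1 1,
      Machine.outputProb_step next_read_second_nil, Machine.outputProb_step next_ask_second,
      outputProb_finish (by omega)]
    rfl
  | cons a w ih =>
    obtain ⟨t, rfl⟩ : ∃ s, t = s + 1 + 1 + 1 := ⟨t - 3, by omega⟩
    rw [List.length_cons] at ht
    rw [Machine.outputProb_step next_read_second_cons, Machine.outputProb_choose next_flip,
      Machine.outputProb_step next_put_second, Machine.outputProb_step next_put_second,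
      ih (by omega), ih (by omega)]
    rfl

/-- The two rounds become nested averages: a first answer `1` rejects at once, and a `0` starts the
second round with an empty query stack. The quantity `m + w.length` is preserved by each letter
read, so the work stack finally holds the length for the second query. -/
theorem outputProb_first {m : ℕ} (ht : 6 * m + 3 * w.length + 5 ≤ t) :
    sampler.outputProb O lam b t (samplerCfg (.read false) v (List.replicate m true) q w) =
      bitAverage (fun y => if O y = true then (if false = b then 1 else 0) else
        bitAverage (fun y => if (!O y) = b then 1 else 0) (m + w.length) []) m q := by
  induction m generalizing v q w t with
  | zero =>
    obtain ⟨t, rfl⟩ : ∃ s, t = s + 1 + 1 := ⟨t - 2, by omega⟩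
    rw [List.replicate_zero, Machine.outputProb_step next_read_first_nil,
      Machine.outputProb_step next_ask_first, bitAverage]
    split_ifs with h
    · rw [outputProb_finish (by omega), if_pos ‹_›]
    · rw [outputProb_finish (by omega), if_neg ‹_›]
    · rw [outputProb_second (by omega), zero_add]
  | succ m ih =>
    obtain ⟨t, rfl⟩ : ∃ s, t = s + 1 + 1 + 1 := ⟨t - 3, by omega⟩
    rw [List.replicate_succ, Machine.outputProb_step next_read_first_cons, if_pos rfl,
      Machine.outputProb_choose next_flip,
      Machine.outputProb_step next_put_first, Machine.outputProb_step next_put_first,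
      ih (by simp; omega), ih (by simp; omega), bitAverage]
    simp only [List.length_cons, Nat.add_right_comm m 1, Nat.add_assoc]

/-- The first `0` in the input leads to rejection before any query, so all coin flips preceding it
average over the same value. -/
theorem outputProb_first_of_false_mem (hi : false ∈ i) (ht : 6 * i.length + 5 ≤ t) :
    sampler.outputProb O lam false t (samplerCfg (.read false) v i q w) = 1 := by
  induction i generalizing v q w t with
  | nil => simp at hi
  | cons a i ih =>
    rw [List.length_cons] at ht
    obtain ⟨t, rfl⟩ : ∃ s, t = s + 1 + 1 + 1 := ⟨t - 3, by omega⟩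
    rw [Machine.outputProb_step next_read_first_cons]
    cases a
    · rw [if_neg (by simp), outputProb_finish (by omega), if_pos rfl]
    · have hi' : false ∈ i := by simpa using hi
      rw [if_pos rfl, Machine.outputProb_choose next_flip, Machine.outputProb_step next_put_first,
        Machine.outputProb_step next_put_first, ih hi' (by omega), ih hi' (by omega)]
      norm_num

/-! ### The two halves of the separation -/

/-- The Deutsch–Jozsa problem can be solved by random sampling, whatever the noise rate of the quantum
device. -/
theorem DeutschJozsaPromise.deutschJozsaLanguage_mem_BQPNoisy (hO : DeutschJozsaPromise O)
    (lam : ℕ → ℝ) : deutschJozsaLanguage O ∈ BQPNoisy lam O := by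
  refine ⟨sampler, 6 * Polynomial.X + 5, fun x => ?_⟩
  have hp : (6 * Polynomial.X + 5 : Polynomial ℕ).eval x.length = 6 * x.length + 5 := by
    simp
  rw [hp, sampler_init]
  refine ⟨haltsWithin_first (w := []), ?_, fun hx => ?_⟩
  · rintro ⟨n, rfl, hn⟩
    rw [outputProb_first (by simp), bitAverage_eq_const (a := 1)]
    · norm_num
    · intro y hy
      rw [hn y (by simpa using hy), if_neg (by simp), bitAverage_eq_const]
      intro z hz
      simp [hn z (by simpa using hz)]
  · by_cases hx' : false ∈ x
    · rw [outputProb_first_of_false_mem hx' le_rfl]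
      norm_num
    · obtain ⟨n, rfl⟩ : ∃ n, x = List.replicate n true :=
        ⟨x.length, List.eq_replicate_iff.2 ⟨rfl, fun b hb => by
          cases b
          · exact absurd hb hx'
          · rfl⟩⟩
      have hbal := (hO n).resolve_left fun h => hx ⟨n, rfl, h⟩
      have hcard : ({x | (x.length = n + ([] : List Bool).length ∧ [] <:+ x) ∧ O x = true}.ncard : ℝ)
          / 2 ^ n = 1 / 2 := by
        rw [div_eq_div_iff (by positivity) (by norm_num)]
        have : ({x | x.length = n ∧ O x = true}.ncard : ℝ) * 2 = 1 * 2 ^ n := by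
          rw [mul_comm, one_mul]
          exact_mod_cast hbal
        simpa using this
      have hneg : (fun y => if (!O y) = false then (1 : ℝ) else 0) =
          fun y => if O y = true then 1 else 0 := by
        funext y
        cases O y <;> rfl
      -- The inner average is `1/2` and the outer one `1/2 + (1 - 1/2) / 2 = 3/4`; a single query
      -- would only reach `1/2`, below the required `2/3`.
      rw [outputProb_first (by simp), List.length_nil, Nat.add_zero, hneg, bitAverage_ite,
        bitAverage_ite, hcard]
      norm_num

/-- There is an oracle that satisfies the promise and whose Deutsch–Jozsa language is not decided by
any nondeterministic polynomial-time machine. -/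
theorem exists_deutschJozsaLanguage_notMem_NPOracle :
    ∃ O, DeutschJozsaPromise O ∧ deutschJozsaLanguage O ∉ NPOracle O := by
  have := countable_natPolynomial
  obtain ⟨e, he⟩ := exists_surjective_nat (NumMachine × Polynomial ℕ)
  obtain ⟨O, hO, herr⟩ := exists_oracle_errs
    (fun i O n => (e i).1.Accepts O (some (e i).1.2.2.1, (e i).1.2.2.2,
      numStacks (List.replicate n true))) fun i => (e i).2
  refine ⟨O, hO, ?_⟩
  rintro ⟨M, p, hM, hdec⟩
  obtain ⟨P, hP⟩ := hM.exists_numMachine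
  obtain ⟨i, hi⟩ := he (P, p)
  obtain ⟨n, ⟨hzero, hcert⟩ | ⟨hzero, hacc⟩⟩ := herr i
  -- On a zero length a correct machine accepts, and its running time bounds the certificate. The
  -- certificate transfers to the code because `hP` holds for every oracle, not only for `O`.
  · refine hcert ?_
    obtain ⟨hhalt, hiff⟩ := hdec (List.replicate n true)
    obtain ⟨Q, hQ, hQ'⟩ := hhalt.exists_certificate (hiff.1 ⟨n, rfl, hzero⟩)
    rw [List.length_replicate] at hQ
    simp only [hi]
    exact ⟨Q, hQ, fun O' h => (hP O' _).1 (hQ' O' h)⟩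
  · simp only [hi] at hacc
    obtain ⟨k, hk, hz⟩ := (hdec (List.replicate n true)).2.2 ((hP O _).2 hacc)
    obtain rfl : n = k := by simpa using congrArg List.length hk
    exact hzero hz

end NoisyQuantum

theorem mainTheorem2 :
    ∃ lam : ℚ, 0 < lam ∧ lam < 1 ∧ ∃ O : NoisyQuantum.Oracle,
      ¬ (NoisyQuantum.BQPNoisy (fun _ => (lam : ℝ)) O ⊆ NoisyQuantum.NPOracle O) ∧
      NoisyQuantum.DeutschJozsaPromise O ∧
      NoisyQuantum.deutschJozsaLanguage O ∈ NoisyQuantum.BQPNoisy (fun _ => (lam : ℝ)) O ∧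
      NoisyQuantum.deutschJozsaLanguage O ∉ NoisyQuantum.NPOracle O := by
  obtain ⟨O, hO, hNP⟩ := NoisyQuantum.exists_deutschJozsaLanguage_notMem_NPOracle
  have hBQP := hO.deutschJozsaLanguage_mem_BQPNoisy
  exact ⟨1 / 2, by norm_num, by norm_num, O, fun h => hNP (h (hBQP _)), hO, hBQP _, hNP⟩
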